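/- **Setting.** An access point with $N$ antennas powers $K$ receivers with $M$ antennas each, in timeslots $l=0,1,2,\dots$. The channel state of slot $l$ is $\mathbf H[l]=(\mathbf H_1[l],\dots,\mathbf H_K[l])$ with $\mathbf H_i[l]\in\mathbb C^{M\times N}$. The states of different slots are independent and have a common law; the matrices of different receivers may be dependent. Put $\mathbf W_i[l]=\mathbf H_i[l]^*\mathbf H_i[l]$. A policy chooses in each slot a beamforming vector $\mathbf x[l]\in\mathbb C^N$ as a measurable function of $\mathbf H[0],\dots,\mathbf H[l]$ and of randomness that is independent of the channels. The transmitted power is $\mathrm{Tr}(\mathbf x[l]\mathbf x[l]^*)=\|\mathbf x[l]\|^2$, and receiver $i$ receives the power $\mathrm{Tr}(\mathbf W_i[l]\mathbf x[l]\mathbf x[l]^*)=\|\mathbf H_i[l]\mathbf x[l]\|^2$. Let $P_{peak}>0$ and $P_1,\dots,P_K\ge 0$. A policy is feasible if $\|\mathbf x[l]\|^2\le P_{peak}$ for all $l$ and $$\liminf_{L\to\infty}\frac1L\sum_{l=0}^{L-1}\mathbb E\big[\mathrm{Tr}(\mathbf W_i[l]\mathbf x[l]\mathbf x[l]^*)\big]\ge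 P_i,\qquad i=1,\dots,K.$$ Assume that some policy is feasible, and let $\bar Q_{opt}$ be the infimum over all feasible policies of $\liminf_{L\to\infty}\frac1L\sum_{l<L}\mathbb E[\mathrm{Tr}(\mathbf x[l]\mathbf x[l]^*)]$. Let $R_i$ be the largest power that receiver $i$ could receive in one slot, $R_i=\sup\{\|\mathbf H_i[0]\mathbf x\|^2:\|\mathbf x\|^2\le P_{peak}\}$, and assume $\mathbb E[\max(P_i,R_i)^2]\le P_{peak}^2$ for every $i$. (Given feasibility, this holds in particular if the received power can almost surely never exceed $P_{peak}$.) **Algorithm (drift-plus-penalty with parameter $V>0$).** Start with $Z_i[0]=0$. In slot $l$ form $\mathbf W'[l]=\sum_{i=1}^K Z_i[l]\mathbf W_i[l]-V\mathbf I_N$. If its largest eigenvalue is positive, put $\mathbf x[l]=\sqrt{P_{peak}}\,\mathbf u$, where $\mathbf u$ is a unit eigenvector for that eigenvalue; otherwise put $\mathbf x[l]=0$. Then update $Z_i[l+1]=\max\{Z_i[l]+P_i-\mathrm{Tr}(\mathbf W_i[l]\mathbf x[l]\mathbf x[l]^*),0\}$. **Theorem 2.** Every policy that follows this algorithm (for any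 choice of the eigenvectors) (a) is feasible; in particular it satisfies the average received-power constraint of every receiver; (b) has an average transmitted power between the optimum and the optimum plus $B/V$: $$\bar Q_{opt}\le\liminf_{L\to\infty}\frac1L\sum_{l=0}^{L-1}\mathbb E[\mathrm{Tr}(\mathbf x[l]\mathbf x[l]^*)]\le\limsup_{L\to\infty}\frac1L\sum_{l=0}^{L-1}\mathbb E[\mathrm{Tr}(\mathbf x[l]\mathbf x[l]^*)]\le\bar Q_{opt}+\frac BV,\qquad B=\frac K2P_{peak}^2.$$ -/

import Mathlib

open MeasureTheory Filter

namespace WPT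

/-- The product (Borel) σ-algebra on complex matrices. -/
noncomputable instance instMeasurableSpaceMatrix {M N : ℕ} : MeasurableSpace (Matrix (Fin M) (Fin N) ℂ) :=
  inferInstanceAs (MeasurableSpace (Fin M → Fin N → ℂ))

/-- The channel state of one timeslot: for every receiver `i`, the complex `M × N` matrix `H i`
from the `N` antennas of the access point to the `M` antennas of receiver `i`. -/
abbrev Channel (K M N : ℕ) : Type := Fin K → Matrix (Fin M) (Fin N) ℂ

/-- Transmitted power `Tr (x x*)` of the beamforming vector `x` (a nonnegative real number). -/
noncomputable def transmitPower {N : ℕ} (x : Fin N → ℂ) : ℝ :=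
  (Matrix.trace (Matrix.vecMulVec x (star x))).re

/-- The Gram matrix `W = H* H`. -/
def gram {M N : ℕ} (H : Matrix (Fin M) (Fin N) ℂ) : Matrix (Fin N) (Fin N) ℂ :=
  H.conjTranspose * H

/-- Received power `Tr (W x x*)`, with `W = H* H` (a nonnegative real number). -/
noncomputable def receivedPower {M N : ℕ} (H : Matrix (Fin M) (Fin N) ℂ) (x : Fin N → ℂ) : ℝ :=
  (Matrix.trace (gram H * Matrix.vecMulVec x (star x))).re

/-- The largest power that can be received over the channel `H` in one timeslot with transmitted
power at most `Ppeak`. -/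
noncomputable def maxReceivedPower {M N : ℕ} (Ppeak : ℝ) (H : Matrix (Fin M) (Fin N) ℂ) : ℝ :=
  sSup {q : ℝ | ∃ x : Fin N → ℂ, transmitPower x ≤ Ppeak ∧ q = receivedPower H x}

/-- The largest (real) eigenvalue of a square matrix; it is only used for Hermitian matrices. -/
noncomputable def lambdaMax {N : ℕ} (A : Matrix (Fin N) (Fin N) ℂ) : ℝ :=
  sSup {r : ℝ | Module.End.HasEigenvalue (Matrix.toLin' A) (r : ℂ)}

/-- A causal, possibly randomized, transmission policy.  The beamforming vector of timeslot `l` is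
a measurable function of the channel states of the timeslots `0, …, l` and of a random seed, which
is uniform on `[0, 1]` and independent of the channels.  One such seed carries the randomness of
all timeslots, and the earlier beamforming vectors are functions of the same data, so that
dependence on the transmission history is included. -/
structure Policy (K M N : ℕ) where
  /-- the beamforming vector of timeslot `l` -/
  act : (l : ℕ) → (Fin (l + 1) → Channel K M N) → unitInterval → (Fin N → ℂ)
  measurable_act : ∀ l : ℕ,
    Measurable fun p : (Fin (l + 1) → Channel K M N) × unitInterval => act l p.1 p.2

namespace Policy

variable {K M N : ℕ}

/-- The beamforming vector `x[l]` along the channel trajectory `H`, with the seed `s`. -/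
def beam (π : Policy K M N) (H : ℕ → Channel K M N) (s : unitInterval) (l : ℕ) : Fin N → ℂ :=
  π.act l (fun j => H j) s

/-- The joint law of the channel trajectory (independent timeslots, each with law `ν`) and the
seed. -/
noncomputable def law (ν : Measure (Channel K M N)) :
    Measure ((ℕ → Channel K M N) × unitInterval) :=
  (Measure.infinitePi fun _ : ℕ => ν).prod volume

/-- `(1 / L) ∑_{l < L} E[Tr (x[l] x[l]*)]`. -/
noncomputable def meanTransmit (ν : Measure (Channel K M N)) (π : Policy K M N) (L : ℕ) : ℝ :=
  (1 / (L : ℝ)) * ∑ l ∈ Finset.range L, ∫ p, transmitPower (π.beam p.1 p.2 l) ∂(law ν)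

/-- `(1 / L) ∑_{l < L} E[Tr (W_i[l] x[l] x[l]*)]`. -/
noncomputable def meanReceived (ν : Measure (Channel K M N)) (π : Policy K M N) (i : Fin K)
    (L : ℕ) : ℝ :=
  (1 / (L : ℝ)) * ∑ l ∈ Finset.range L, ∫ p, receivedPower (p.1 l i) (π.beam p.1 p.2 l) ∂(law ν)

/-- The peak power constraint holds in every timeslot, and the long-term average received power of
every receiver `i` is at least `P i`.  (A lower limit is used, so that policies whose averages do
not converge are covered as well.) -/
def IsFeasible (ν : Measure (Channel K M N)) (Ppeak : ℝ) (P : Fin K → ℝ) (π : Policy K M N) :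
    Prop :=
  (∀ H s l, transmitPower (π.beam H s l) ≤ Ppeak) ∧
    ∀ i, P i ≤ liminf (π.meanReceived ν i) atTop

/-- The virtual queues: `Z_i[0] = 0` and
`Z_i[l+1] = max (Z_i[l] + P_i - Tr (W_i[l] x[l] x[l]*)) 0`. -/
noncomputable def queue (P : Fin K → ℝ) (π : Policy K M N) (H : ℕ → Channel K M N)
    (s : unitInterval) : ℕ → Fin K → ℝ
  | 0 => fun _ => 0
  | l + 1 => fun i =>
      max (queue P π H s l i + P i - receivedPower (H l i) (π.beam H s l)) 0

/-- `W'[l] = ∑_i Z_i[l] W_i[l] - V I`. -/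
noncomputable def weighted (V : ℝ) (P : Fin K → ℝ) (π : Policy K M N) (H : ℕ → Channel K M N)
    (s : unitInterval) (l : ℕ) : Matrix (Fin N) (Fin N) ℂ :=
  ∑ i, (queue P π H s l i : ℂ) • gram (H l i) - (V : ℂ) • (1 : Matrix (Fin N) (Fin N) ℂ)

/-- The policy runs the drift-plus-penalty algorithm: if the largest eigenvalue of `W'[l]` is
positive, it transmits with power `Ppeak` in the direction of a unit eigenvector for that
eigenvalue; otherwise it does not transmit.  Any choice of the unit eigenvector is allowed. -/
def IsDriftPlusPenalty (V Ppeak : ℝ) (P : Fin K → ℝ) (π : Policy K M N) : Prop :=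
  ∀ H s l,
    (0 < lambdaMax (π.weighted V P H s l) →
      ∃ u : Fin N → ℂ, transmitPower u = 1 ∧
        Matrix.mulVec (π.weighted V P H s l) u
          = (lambdaMax (π.weighted V P H s l) : ℂ) • u ∧
        π.beam H s l = (Real.sqrt Ppeak : ℂ) • u) ∧
    (lambdaMax (π.weighted V P H s l) ≤ 0 → π.beam H s l = 0)

end Policy

/-- The optimal average transmitted power: the infimum over all feasible policies of the long-term
average transmitted power.  (For a policy whose averages do not converge the lower limit is taken,
which makes the optimum the most demanding benchmark.) -/
noncomputable def optimalPower {K M N : ℕ} (ν : Measure (Channel K M N)) (Ppeak : ℝ)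
    (P : Fin K → ℝ) : ℝ :=
  sInf {q : ℝ | ∃ π : Policy K M N, π.IsFeasible ν Ppeak P ∧
    q = liminf (π.meanTransmit ν) atTop}

end WPT

/-!
The proof compares the algorithm, slot by slot, with an arbitrary feasible policy `φ`.

Write `r_i` for the power received in a slot. The update rule gives
`Z_i[l+1]² ≤ Z_i[l]² + 2 Z_i[l] (P_i - r_i) + (P_i - r_i)²`, and the last term has expectation at
most `Ppeak²` because `|P_i - r_i| ≤ max (P_i, R_i)`. So the growth of `½ ∑ Z_i²` plus `V` times
the transmitted power is controlled by the score `∑ Z_i (P_i - r_i) + V ‖x‖²`, and the algorithm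
minimises this score pointwise over all beamforming vectors of power at most `Ppeak`: up to the
constant `∑ Z_i P_i` and the sign it is the quadratic form of the Hermitian matrix `W'`, whose
maximum is attained at an eigenvector for the largest eigenvalue if that is positive, and at `0`
otherwise
(`WPT.Policy.IsDriftPlusPenalty.optimal`).

The policy `φ` may depend on the whole history, hence on the data that determine the queues. It is
therefore replaced by a competitor that keeps the true channel `H[l]` of the current slot, but
draws all the other inputs of the rule of `φ` for a slot `m` independently afresh. The competitor
has the same mean transmitted and received powers as `φ` in slot `m`, and what it does in slot `l`
is independent of the queues, which involve only channels before slot `l` and the seed. The only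
probabilistic input is that replacing the channel of one slot by an independent copy preserves the
joint law
(`WPT.measurePreserving_resample`). This gives
`WPT.Policy.IsDriftPlusPenalty.compare_slot`. Averaging over `m < L` and letting `L` tend to
infinity along a sequence that realises the lower limit `q` of the power of `φ`, the received-power
terms become nonpositive in the limit, so the expected score of the algorithm is at most `V q` in
every slot (`WPT.Policy.IsDriftPlusPenalty.compare_liminf`).

Summing over the slots, `E[½ ∑ Z_i[L]²] + V ∑_{l < L} E‖x[l]‖² ≤ L (B + V q)`
(`WPT.Policy.IsDriftPlusPenalty.lyapunov_le`). Dropping the first term bounds the average power by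
`q + B / V`. Dropping the second shows that `E Z_i[L]` is of order `√L`; since `Z_i[L]` dominates
the accumulated deficit `∑_{l < L} (P_i - r_i[l])`, the average deficit is nonpositive in the limit,
which is feasibility.
-/

namespace WPT

/-! ### Powers as quadratic forms -/

/-- The real part of the quadratic form `x* A x`, written as a trace so that it is visibly linear
in `A`. -/
noncomputable def quadForm {N : ℕ} (A : Matrix (Fin N) (Fin N) ℂ) (x : Fin N → ℂ) : ℝ :=
  (Matrix.trace (A * Matrix.vecMulVec x (star x))).re

section Deterministic

variable {K M N : ℕ}

lemma quadForm_eq_dotProduct (A : Matrix (Fin N) (Fin N) ℂ) (x : Fin N → ℂ) :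
    quadForm A x = (star x ⬝ᵥ A.mulVec x).re := by
  rw [quadForm, Matrix.mul_vecMulVec, Matrix.trace_vecMulVec, dotProduct_comm]

lemma quadForm_one (x : Fin N → ℂ) : quadForm 1 x = transmitPower x := by
  rw [quadForm, one_mul, transmitPower]

lemma quadForm_gram (H : Matrix (Fin M) (Fin N) ℂ) (x : Fin N → ℂ) :
    quadForm (gram H) x = receivedPower H x := rfl

lemma transmitPower_eq_sum (x : Fin N → ℂ) : transmitPower x = ∑ j, ‖x j‖ ^ 2 := by
  rw [transmitPower, Matrix.trace_vecMulVec, dotProduct, Complex.re_sum]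
  refine Finset.sum_congr rfl fun j _ => ?_
  rw [Pi.star_apply, Complex.star_def, Complex.mul_conj, Complex.ofReal_re,
    Complex.normSq_eq_norm_sq]

lemma receivedPower_eq_transmitPower (H : Matrix (Fin M) (Fin N) ℂ) (x : Fin N → ℂ) :
    receivedPower H x = transmitPower (H.mulVec x) := by
  rw [receivedPower, transmitPower, gram, Matrix.mul_vecMulVec, Matrix.trace_vecMulVec,
    Matrix.trace_vecMulVec, ← Matrix.mulVec_mulVec, dotProduct_comm, dotProduct_comm _ (star _),
    Matrix.star_mulVec, Matrix.dotProduct_mulVec]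

lemma transmitPower_nonneg (x : Fin N → ℂ) : 0 ≤ transmitPower x := by
  rw [transmitPower_eq_sum]; positivity

lemma receivedPower_nonneg (H : Matrix (Fin M) (Fin N) ℂ) (x : Fin N → ℂ) :
    0 ≤ receivedPower H x := by
  rw [receivedPower_eq_transmitPower]; exact transmitPower_nonneg _

lemma transmitPower_zero : transmitPower (0 : Fin N → ℂ) = 0 := by
  simp [transmitPower_eq_sum]

lemma transmitPower_sqrt_smul {c : ℝ} (hc : 0 ≤ c) (x : Fin N → ℂ) :
    transmitPower ((Real.sqrt c : ℂ) • x) = c * transmitPower x := by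
  simp only [transmitPower_eq_sum, Pi.smul_apply, smul_eq_mul, norm_mul, mul_pow, Finset.mul_sum]
  simp [Real.sq_sqrt hc]

/-- The received power is at most the squared Frobenius norm of the channel times the transmitted
power. -/
lemma receivedPower_le (H : Matrix (Fin M) (Fin N) ℂ) (x : Fin N → ℂ) :
    receivedPower H x ≤ (∑ a, ∑ b, ‖H a b‖ ^ 2) * transmitPower x := by
  rw [receivedPower_eq_transmitPower, transmitPower_eq_sum, transmitPower_eq_sum, Finset.sum_mul]
  refine Finset.sum_le_sum fun a _ => ?_
  calc ‖(H.mulVec x) a‖ ^ 2 ≤ (∑ b, ‖H a b‖ * ‖x b‖) ^ 2 := by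
        gcongr
        exact (norm_sum_le Finset.univ fun b => H a b * x b).trans_eq (by simp)
    _ ≤ _ := Finset.sum_mul_sq_le_sq_mul_sq _ _ _

lemma receivedPower_le_maxReceivedPower {Ppeak : ℝ} (H : Matrix (Fin M) (Fin N) ℂ)
    {x : Fin N → ℂ} (hx : transmitPower x ≤ Ppeak) :
    receivedPower H x ≤ maxReceivedPower Ppeak H := by
  refine le_csSup ⟨(∑ a, ∑ b, ‖H a b‖ ^ 2) * Ppeak, ?_⟩ ⟨x, hx, rfl⟩
  rintro _ ⟨y, hy, rfl⟩
  exact (receivedPower_le H y).trans (by gcongr)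

/-! ### The largest eigenvalue bounds the quadratic form -/

lemma le_lambdaMax {A : Matrix (Fin N) (Fin N) ℂ} {r : ℝ}
    (hr : Module.End.HasEigenvalue (Matrix.toLin' A) (r : ℂ)) : r ≤ lambdaMax A := by
  refine le_csSup (Set.Finite.bddAbove ?_) hr
  exact (Module.End.finite_hasEigenvalue (Matrix.toLin' A)).preimage
    Complex.ofReal_injective.injOn

open scoped ComplexOrder in
/-- The Rayleigh bound: `lambdaMax A • 1 - A` has no negative eigenvalue, so it is positive
semidefinite. -/
lemma quadForm_le_lambdaMax {A : Matrix (Fin N) (Fin N) ℂ} (hA : A.IsHermitian)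
    (x : Fin N → ℂ) : quadForm A x ≤ lambdaMax A * transmitPower x := by
  have hB : ((lambdaMax A : ℂ) • (1 : Matrix (Fin N) (Fin N) ℂ) - A).IsHermitian := by
    refine Matrix.IsHermitian.sub ?_ hA
    rw [Matrix.IsHermitian, Matrix.conjTranspose_smul, Matrix.conjTranspose_one]
    simp
  have hpos : ((lambdaMax A : ℂ) • (1 : Matrix (Fin N) (Fin N) ℂ) - A).PosSemidef := by
    rw [hB.posSemidef_iff_eigenvalues_nonneg]
    intro j
    have hj := hB.mulVec_eigenvectorBasis j
    have hne : (hB.eigenvectorBasis j : Fin N → ℂ) ≠ 0 := fun h =>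
      hB.eigenvectorBasis.orthonormal.ne_zero j (by ext k; exact congrFun h k)
    have : lambdaMax A - hB.eigenvalues j ≤ lambdaMax A := by
      refine le_lambdaMax (Module.End.hasEigenvalue_of_hasEigenvector
        (x := (hB.eigenvectorBasis j : Fin N → ℂ)) ⟨?_, hne⟩)
      rw [Module.End.mem_eigenspace_iff, Matrix.toLin'_apply]
      rw [Matrix.sub_mulVec, Matrix.smul_mulVec, Matrix.one_mulVec] at hj
      push_cast
      rw [sub_smul, eq_sub_iff_add_eq, ← eq_sub_iff_add_eq', hj]
      rfl
    simpa using this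
  have h := (RCLike.nonneg_iff.1 (hpos.dotProduct_mulVec_nonneg x)).1
  have h2 : quadForm ((lambdaMax A : ℂ) • (1 : Matrix (Fin N) (Fin N) ℂ) - A) x
      = lambdaMax A * transmitPower x - quadForm A x := by
    rw [← quadForm_one]
    simp [quadForm, sub_mul, Matrix.trace_sub]
  rw [quadForm_eq_dotProduct] at h2
  have h3 : 0 ≤ (star x ⬝ᵥ
    ((lambdaMax A : ℂ) • (1 : Matrix (Fin N) (Fin N) ℂ) - A).mulVec x).re := h
  linarith

/-! ### The algorithm minimises drift plus penalty in every slot -/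

lemma quadForm_weighted (V : ℝ) (Z : Fin K → ℝ) (h : Channel K M N) (x : Fin N → ℂ) :
    quadForm (∑ i, (Z i : ℂ) • gram (h i) - (V : ℂ) • (1 : Matrix (Fin N) (Fin N) ℂ)) x
      = ∑ i, Z i * receivedPower (h i) x - V * transmitPower x := by
  simp only [← quadForm_one, ← quadForm_gram]
  simp [quadForm, sub_mul, Matrix.trace_sub, Finset.sum_mul, Matrix.trace_sum]

lemma isHermitian_weighted (V : ℝ) (Z : Fin K → ℝ) (h : Channel K M N) :
    (∑ i, (Z i : ℂ) • gram (h i) - (V : ℂ) • (1 : Matrix (Fin N) (Fin N) ℂ)).IsHermitian := by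
  rw [Matrix.IsHermitian]
  simp [gram, Matrix.conjTranspose_sum]

namespace Policy

variable {V Ppeak : ℝ} {P : Fin K → ℝ} {π : Policy K M N}

lemma IsDriftPlusPenalty.transmitPower_le (hP : 0 < Ppeak) (hπ : π.IsDriftPlusPenalty V Ppeak P)
    (H : ℕ → Channel K M N) (s : unitInterval) (l : ℕ) :
    transmitPower (π.beam H s l) ≤ Ppeak := by
  obtain ⟨h1, h2⟩ := hπ H s l
  rcases lt_or_ge 0 (lambdaMax (π.weighted V P H s l)) with h | h
  · obtain ⟨u, hu, -, hb⟩ := h1 h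
    rw [hb, transmitPower_sqrt_smul hP.le, hu, mul_one]
  · rw [h2 h, transmitPower_zero]; exact hP.le

/-- Among all beamforming vectors of power at most `Ppeak`, the one that the algorithm chooses
maximises `∑ Z_i r_i - V ‖x‖²`. -/
lemma IsDriftPlusPenalty.optimal (hP : 0 < Ppeak) (hπ : π.IsDriftPlusPenalty V Ppeak P)
    (H : ℕ → Channel K M N) (s : unitInterval) (l : ℕ) {y : Fin N → ℂ}
    (hy : transmitPower y ≤ Ppeak) :
    ∑ i, π.queue P H s l i * receivedPower (H l i) y - V * transmitPower y ≤
      ∑ i, π.queue P H s l i * receivedPower (H l i) (π.beam H s l)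
        - V * transmitPower (π.beam H s l) := by
  obtain ⟨h1, h2⟩ := hπ H s l
  have hW := quadForm_le_lambdaMax (isHermitian_weighted V (π.queue P H s l) (H l)) y
  rw [← quadForm_weighted, ← quadForm_weighted]
  change quadForm (π.weighted V P H s l) y ≤ lambdaMax (π.weighted V P H s l) * _ at hW
  change quadForm (π.weighted V P H s l) y ≤ quadForm (π.weighted V P H s l) _
  rcases lt_or_ge 0 (lambdaMax (π.weighted V P H s l)) with h | h
  · obtain ⟨u, hu, he, hb⟩ := h1 h
    have hx : quadForm (π.weighted V P H s l) (π.beam H s l)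
        = lambdaMax (π.weighted V P H s l) * transmitPower (π.beam H s l) := by
      rw [hb, ← quadForm_one, quadForm_eq_dotProduct, quadForm_eq_dotProduct, Matrix.mulVec_smul,
        he, smul_comm, dotProduct_smul, Matrix.one_mulVec]
      simp
    rw [hx, hb, transmitPower_sqrt_smul hP.le, hu, mul_one]
    exact hW.trans (by gcongr)
  · have : quadForm (π.weighted V P H s l) (π.beam H s l) = 0 := by
      rw [h2 h, quadForm_eq_dotProduct]; simp
    rw [this]
    exact hW.trans (mul_nonpos_of_nonpos_of_nonneg h (transmitPower_nonneg y))

/-! ### Virtual queues -/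

lemma queue_nonneg (H : ℕ → Channel K M N) (s : unitInterval) (l : ℕ) (i : Fin K) :
    0 ≤ π.queue P H s l i := by
  cases l with
  | zero => exact le_rfl
  | succ l => exact le_max_right _ _

lemma queue_le (hP : ∀ i, 0 ≤ P i) (H : ℕ → Channel K M N) (s : unitInterval) (l : ℕ)
    (i : Fin K) : π.queue P H s l i ≤ l * P i := by
  induction l with
  | zero => simp [queue]
  | succ l ih =>
    refine max_le ?_ (mul_nonneg (Nat.cast_nonneg _) (hP i))
    have := receivedPower_nonneg (H l i) (π.beam H s l)
    push_cast
    linarith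

lemma sum_le_queue (H : ℕ → Channel K M N) (s : unitInterval) (L : ℕ) (i : Fin K) :
    ∑ l ∈ Finset.range L, (P i - receivedPower (H l i) (π.beam H s l)) ≤ π.queue P H s L i := by
  induction L with
  | zero => simp [queue]
  | succ l ih =>
    rw [Finset.sum_range_succ]
    refine le_trans ?_ (le_max_left _ _)
    linarith

lemma queue_succ_sq_le (H : ℕ → Channel K M N) (s : unitInterval) (l : ℕ) (i : Fin K) :
    π.queue P H s (l + 1) i ^ 2 ≤ π.queue P H s l i ^ 2
      + 2 * (π.queue P H s l i * (P i - receivedPower (H l i) (π.beam H s l)))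
      + (P i - receivedPower (H l i) (π.beam H s l)) ^ 2 := by
  change max (π.queue P H s l i + P i - receivedPower (H l i) (π.beam H s l)) 0 ^ 2 ≤ _
  have h : ∀ a : ℝ, max a 0 ^ 2 ≤ a ^ 2 := fun a => by
    rcases le_total a 0 with h | h
    · rw [max_eq_right h]; simpa using sq_nonneg a
    · rw [max_eq_left h]
  exact (h _).trans_eq (by ring)

/-- The beamforming vector of slot `l` depends on the channels only up to slot `l`. -/
lemma beam_congr {H H' : ℕ → Channel K M N} (s : unitInterval) {l : ℕ}
    (h : ∀ j ≤ l, H j = H' j) : π.beam H s l = π.beam H' s l := by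
  unfold beam
  congr 1
  exact funext fun j => h j (Nat.lt_succ_iff.1 j.2)

/-- The queue at the start of slot `l` depends only on the channels of earlier slots. -/
lemma queue_congr {H H' : ℕ → Channel K M N} (s : unitInterval) {l : ℕ}
    (h : ∀ j < l, H j = H' j) : π.queue P H s l = π.queue P H' s l := by
  induction l with
  | zero => rfl
  | succ l ih =>
    funext i
    simp only [queue]
    rw [ih fun j hj => h j (hj.trans l.lt_succ_self), h l l.lt_succ_self,
      beam_congr s fun j hj => h j (Nat.lt_succ_iff.2 hj)]

end Policy
end Deterministic

/-! ### Measurability of the powers -/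

section Measurability

variable {K M N : ℕ}

instance instBorelSpaceMatrix : BorelSpace (Matrix (Fin M) (Fin N) ℂ) :=
  inferInstanceAs (BorelSpace (Fin M → Fin N → ℂ))

lemma measurable_transmitPower : Measurable (transmitPower : (Fin N → ℂ) → ℝ) := by
  have : (transmitPower : (Fin N → ℂ) → ℝ) = fun x => ∑ j, ‖x j‖ ^ 2 :=
    funext transmitPower_eq_sum
  rw [this]
  fun_prop

lemma measurable_receivedPower {α : Type*} [MeasurableSpace α]
    {f : α → Matrix (Fin M) (Fin N) ℂ} {g : α → Fin N → ℂ} (hf : Measurable f)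
    (hg : Measurable g) : Measurable fun a => receivedPower (f a) (g a) := by
  simp only [receivedPower_eq_transmitPower]
  refine measurable_transmitPower.comp (measurable_pi_lambda _ fun a => ?_)
  simp only [Matrix.mulVec, dotProduct]
  refine Finset.measurable_fun_sum _ fun b _ => Measurable.mul ?_ ((measurable_pi_apply b).comp hg)
  exact (measurable_pi_apply b).comp
    ((measurable_pi_apply (X := fun _ : Fin M => Fin N → ℂ) a).comp hf)

lemma continuous_receivedPower (x : Fin N → ℂ) :
    Continuous fun H : Matrix (Fin M) (Fin N) ℂ => receivedPower H x := by
  simp only [receivedPower_eq_transmitPower, transmitPower_eq_sum]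
  fun_prop

/-- A supremum of continuous functions is lower semicontinuous, hence measurable. -/
lemma measurable_maxReceivedPower (Ppeak : ℝ) :
    Measurable (maxReceivedPower Ppeak : Matrix (Fin M) (Fin N) ℂ → ℝ) := by
  have h : (maxReceivedPower Ppeak : Matrix (Fin M) (Fin N) ℂ → ℝ)
      = fun H => ⨆ x : {x : Fin N → ℂ // transmitPower x ≤ Ppeak}, receivedPower H x := by
    funext H
    rw [maxReceivedPower, iSup]
    congr 1
    ext q
    simp [eq_comm]
  rw [h]
  have hb : ∀ H : Matrix (Fin M) (Fin N) ℂ, BddAbove (Set.range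
      fun x : {x : Fin N → ℂ // transmitPower x ≤ Ppeak} => receivedPower H x.1) := by
    rintro H
    refine ⟨maxReceivedPower Ppeak H, ?_⟩
    rintro _ ⟨x, rfl⟩
    exact receivedPower_le_maxReceivedPower H x.2
  exact (lowerSemicontinuous_ciSup hb
    fun x => (continuous_receivedPower x.1).lowerSemicontinuous).measurable

lemma integrable_sq_bound {ν : Measure (Channel K M N)} {Ppeak c : ℝ} {i : Fin K}
    (hbound : ∫⁻ h, ENNReal.ofReal (max c (maxReceivedPower Ppeak (h i)) ^ 2) ∂ν
      ≤ ENNReal.ofReal (Ppeak ^ 2)) :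
    Integrable (fun h : Channel K M N => max c (maxReceivedPower Ppeak (h i)) ^ 2) ν ∧
      ∫ h, max c (maxReceivedPower Ppeak (h i)) ^ 2 ∂ν ≤ Ppeak ^ 2 := by
  have hm : Measurable (fun h : Channel K M N => max c (maxReceivedPower Ppeak (h i)) ^ 2) :=
    (measurable_const.max ((measurable_maxReceivedPower Ppeak).comp
      (measurable_pi_apply i))).pow_const 2
  have h0 : 0 ≤ᵐ[ν] fun h : Channel K M N => max c (maxReceivedPower Ppeak (h i)) ^ 2 :=
    .of_forall fun h => sq_nonneg _
  refine ⟨⟨hm.aestronglyMeasurable, ?_⟩, ?_⟩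
  · rw [hasFiniteIntegral_iff_ofReal h0]
    exact hbound.trans_lt ENNReal.ofReal_lt_top
  · rw [integral_eq_lintegral_of_nonneg_ae h0 hm.aestronglyMeasurable]
    exact ENNReal.toReal_le_of_le_ofReal (sq_nonneg _) hbound

namespace Policy

variable (π : Policy K M N)

lemma measurable_beam (l : ℕ) :
    Measurable fun p : (ℕ → Channel K M N) × unitInterval => π.beam p.1 p.2 l := by
  refine (π.measurable_act l).comp (Measurable.prodMk ?_ measurable_snd)
  exact measurable_pi_lambda _ fun j => (measurable_pi_apply (j : ℕ)).comp measurable_fst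

lemma measurable_transmitPower_beam (l : ℕ) :
    Measurable fun p : (ℕ → Channel K M N) × unitInterval => transmitPower (π.beam p.1 p.2 l) :=
  measurable_transmitPower.comp (π.measurable_beam l)

lemma measurable_receivedPower_beam (l : ℕ) (i : Fin K) :
    Measurable fun p : (ℕ → Channel K M N) × unitInterval =>
      receivedPower (p.1 l i) (π.beam p.1 p.2 l) :=
  measurable_receivedPower
    ((measurable_pi_apply i).comp ((measurable_pi_apply l).comp measurable_fst))
    (π.measurable_beam l)

lemma measurable_queue (P : Fin K → ℝ) (l : ℕ) (i : Fin K) :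
    Measurable fun p : (ℕ → Channel K M N) × unitInterval => π.queue P p.1 p.2 l i := by
  induction l with
  | zero => exact measurable_const
  | succ l ih =>
    exact ((ih.add_const _).sub (π.measurable_receivedPower_beam l i)).max measurable_const

lemma norm_queue_le {P : Fin K → ℝ} (hP : ∀ i, 0 ≤ P i) (l : ℕ) (i : Fin K)
    (p : (ℕ → Channel K M N) × unitInterval) : ‖π.queue P p.1 p.2 l i‖ ≤ l * P i := by
  rw [Real.norm_of_nonneg (queue_nonneg _ _ _ _)]
  exact queue_le hP _ _ _ _

lemma integrable_queue_mul {P : Fin K → ℝ}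
    {μ : Measure ((ℕ → Channel K M N) × unitInterval)} (hP : ∀ i, 0 ≤ P i) (l : ℕ) (i : Fin K)
    {f : (ℕ → Channel K M N) × unitInterval → ℝ} (hf : Integrable f (μ)) :
    Integrable (fun p => π.queue P p.1 p.2 l i * f p) (μ) :=
  hf.bdd_mul (π.measurable_queue P l i).aestronglyMeasurable (.of_forall (π.norm_queue_le hP l i))

end Policy
end Measurability

/-! ### Resampling one slot -/

section Resampling

variable {K M N : ℕ} (ν : Measure (Channel K M N)) [IsProbabilityMeasure ν]

instance instIsProbabilityMeasureLaw : IsProbabilityMeasure (Policy.law ν) := by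
  unfold Policy.law; infer_instance

lemma measurePreserving_update_infinitePi {X : Type*} [MeasurableSpace X] (μ : Measure X)
    [IsProbabilityMeasure μ] (l : ℕ) :
    MeasurePreserving (fun p : X × (ℕ → X) => Function.update p.2 l p.1)
      (μ.prod (Measure.infinitePi fun _ : ℕ => μ)) (Measure.infinitePi fun _ : ℕ => μ) := by
  have hm : Measurable fun p : X × (ℕ → X) => Function.update p.2 l p.1 := by
    refine measurable_pi_lambda _ fun j => ?_
    by_cases h : j = l
    · subst h; simpa using measurable_fst
    · simp only [Function.update_of_ne h]; exact (measurable_pi_apply j).comp measurable_snd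
  refine ⟨hm, Measure.eq_infinitePi _ fun s t ht => ?_⟩
  rw [Measure.map_apply hm (MeasurableSet.pi s.countable_toSet fun i _ => ht i)]
  by_cases hl : l ∈ s
  · have : (fun p : X × (ℕ → X) => Function.update p.2 l p.1) ⁻¹' (Set.pi s t)
        = t l ×ˢ Set.pi (s.erase l : Finset ℕ) t := by
      ext ⟨x, y⟩
      simp only [Set.mem_preimage, Set.mem_pi, Set.mem_prod, Finset.mem_coe, Finset.mem_erase]
      constructor
      · intro h
        exact ⟨by simpa using h l hl, fun j hj => by
          simpa [Function.update_of_ne hj.1] using h j hj.2⟩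
      · rintro ⟨h1, h2⟩ j hj
        by_cases hjl : j = l
        · subst hjl; simpa using h1
        · simpa [Function.update_of_ne hjl] using h2 j ⟨hjl, hj⟩
    rw [this, Measure.prod_prod, Measure.infinitePi_pi _ fun i _ => ht i,
      Finset.mul_prod_erase s (fun i => μ (t i)) hl]
  · have : (fun p : X × (ℕ → X) => Function.update p.2 l p.1) ⁻¹' (Set.pi s t)
        = Set.univ ×ˢ Set.pi s t := by
      ext ⟨x, y⟩
      simp only [Set.mem_preimage, Set.mem_pi, Set.mem_prod, Finset.mem_coe, Set.mem_univ,
        true_and]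
      refine forall₂_congr fun j hj => ?_
      rw [Function.update_of_ne (ne_of_mem_of_not_mem hj hl)]
    rw [this, Measure.prod_prod, Measure.infinitePi_pi _ fun i _ => ht i, measure_univ, one_mul]

/-- The sample point in which the channel of slot `l` is replaced by `q.1`. -/
def resample (l : ℕ) (q : Channel K M N × ((ℕ → Channel K M N) × unitInterval)) :
    (ℕ → Channel K M N) × unitInterval :=
  (Function.update q.2.1 l q.1, q.2.2)

/-- Replacing the channel of one slot by an independent copy does not change the joint law.  All
uses of the independence of the slots go through this fact. -/
lemma measurePreserving_resample (l : ℕ) :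
    MeasurePreserving (resample (K := K) (M := M) (N := N) l) (ν.prod (Policy.law ν))
      (Policy.law ν) :=
  ((measurePreserving_update_infinitePi ν l).prod (MeasurePreserving.id volume)).comp
    (measurePreserving_prodAssoc ν (Measure.infinitePi fun _ : ℕ => ν) volume).symm

lemma measurePreserving_slot (l : ℕ) :
    MeasurePreserving (fun p : (ℕ → Channel K M N) × unitInterval => p.1 l) (Policy.law ν) ν :=
  (measurePreserving_eval_infinitePi (fun _ : ℕ => ν) l).comp measurePreserving_fst

end Resampling

/-! ### Conditioning on the channel of one slot -/

section Expectation

variable {K M N : ℕ} {ν : Measure (Channel K M N)} [IsProbabilityMeasure ν]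

lemma resample_slot (l : ℕ) (h : Channel K M N) (p : (ℕ → Channel K M N) × unitInterval) :
    (resample l (h, p)).1 l = h := Function.update_self ..

/-- The conditional expectation of `A` given that the channel of slot `l` is `h`. -/
noncomputable def slotMean (ν : Measure (Channel K M N)) (l : ℕ)
    (A : (ℕ → Channel K M N) × unitInterval → ℝ) (h : Channel K M N) : ℝ :=
  ∫ p, A (resample l (h, p)) ∂(Policy.law ν)

lemma integrable_slotMean {l : ℕ} {A : (ℕ → Channel K M N) × unitInterval → ℝ}
    (hA : Integrable A (Policy.law ν)) : Integrable (slotMean ν l A) ν :=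
  ((measurePreserving_resample ν l).integrable_comp_of_integrable hA).integral_prod_left

lemma integral_slotMean {l : ℕ} {A : (ℕ → Channel K M N) × unitInterval → ℝ}
    (hA : Integrable A (Policy.law ν)) : ∫ h, slotMean ν l A h ∂ν = ∫ p, A p ∂(Policy.law ν) := by
  have hr := measurePreserving_resample ν l
  rw [← hr.map_eq, integral_map hr.aemeasurable (by rw [hr.map_eq]; exact hA.1)]
  exact (integral_prod _ (hr.integrable_comp_of_integrable hA)).symm

lemma integral_slot {l : ℕ} {g : Channel K M N → ℝ} (hg : AEStronglyMeasurable g ν) :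
    ∫ p, g (p.1 l) ∂(Policy.law ν) = ∫ h, g h ∂ν := by
  have hs := measurePreserving_slot ν l
  have := integral_map (f := g) hs.aemeasurable (by rw [hs.map_eq]; exact hg)
  rw [hs.map_eq] at this
  exact this.symm

/-- A random variable that ignores the channel of slot `l` is uncorrelated with every function of
that channel. -/
lemma integral_mul_slot {l : ℕ} {f : (ℕ → Channel K M N) × unitInterval → ℝ}
    {g : Channel K M N → ℝ} (hf : ∀ h p, f (resample l (h, p)) = f p)
    (hfm : AEStronglyMeasurable f (Policy.law ν)) (hg : AEStronglyMeasurable g ν) :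
    ∫ p, f p * g (p.1 l) ∂(Policy.law ν) = (∫ p, f p ∂(Policy.law ν)) * ∫ h, g h ∂ν := by
  have hr := measurePreserving_resample ν l
  have hm : AEStronglyMeasurable (fun p : (ℕ → Channel K M N) × unitInterval => f p * g (p.1 l))
      (Policy.law ν) :=
    hfm.mul (hg.comp_measurePreserving (measurePreserving_slot ν l))
  conv_lhs => rw [← hr.map_eq]
  rw [integral_map hr.aemeasurable (by rw [hr.map_eq]; exact hm), mul_comm, ← integral_prod_mul]
  refine integral_congr_ae (.of_forall fun q => ?_)
  obtain ⟨h, p⟩ := q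
  simp only [hf, resample_slot, mul_comm]

/-! ### Moments of the powers -/

namespace Policy

variable {Ppeak : ℝ} {P : Fin K → ℝ} {φ : Policy K M N}

lemma abs_sub_receivedPower_le {x : Fin N → ℂ} {H : Matrix (Fin M) (Fin N) ℂ} {c : ℝ}
    (hc : 0 ≤ c) (hx : transmitPower x ≤ Ppeak) :
    |c - receivedPower H x| ≤ max c (maxReceivedPower Ppeak H) := by
  have h1 := receivedPower_nonneg H x
  have h2 := receivedPower_le_maxReceivedPower H hx
  rw [abs_le]
  constructor
  · linarith [le_max_right c (maxReceivedPower Ppeak H)]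
  · linarith [le_max_left c (maxReceivedPower Ppeak H)]

lemma integrable_sub_receivedPower_sq (hP : ∀ i, 0 ≤ P i)
    (hbound : ∀ i, ∫⁻ h, ENNReal.ofReal (max (P i) (maxReceivedPower Ppeak (h i)) ^ 2) ∂ν
      ≤ ENNReal.ofReal (Ppeak ^ 2))
    (hφ : ∀ H s l, transmitPower (φ.beam H s l) ≤ Ppeak) (l : ℕ) (i : Fin K) :
    Integrable (fun p : (ℕ → Channel K M N) × unitInterval =>
      (P i - receivedPower (p.1 l i) (φ.beam p.1 p.2 l)) ^ 2) (law ν) ∧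
    ∫ p, (P i - receivedPower (p.1 l i) (φ.beam p.1 p.2 l)) ^ 2 ∂(law ν) ≤ Ppeak ^ 2 := by
  obtain ⟨hi, hle⟩ := integrable_sq_bound (hbound i)
  have hs := measurePreserving_slot ν l
  have hi' := hs.integrable_comp_of_integrable hi
  have hb : ∀ p : (ℕ → Channel K M N) × unitInterval,
      (P i - receivedPower (p.1 l i) (φ.beam p.1 p.2 l)) ^ 2
        ≤ max (P i) (maxReceivedPower Ppeak (p.1 l i)) ^ 2 := fun p =>
    sq_le_sq' (neg_le_of_abs_le (abs_sub_receivedPower_le (hP i) (hφ _ _ _)))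
      (le_of_abs_le (abs_sub_receivedPower_le (hP i) (hφ _ _ _)))
  have hint : Integrable (fun p : (ℕ → Channel K M N) × unitInterval =>
      (P i - receivedPower (p.1 l i) (φ.beam p.1 p.2 l)) ^ 2) (law ν) := by
    refine hi'.mono' (((φ.measurable_receivedPower_beam l i).const_sub
      _).pow_const 2).aestronglyMeasurable (.of_forall fun p => ?_)
    rw [Real.norm_of_nonneg (sq_nonneg _)]
    exact hb p
  refine ⟨hint, (integral_mono hint hi' hb).trans (le_of_eq_of_le ?_ hle)⟩
  exact integral_slot hi.1

lemma integrable_receivedPower (hP : ∀ i, 0 ≤ P i)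
    (hbound : ∀ i, ∫⁻ h, ENNReal.ofReal (max (P i) (maxReceivedPower Ppeak (h i)) ^ 2) ∂ν
      ≤ ENNReal.ofReal (Ppeak ^ 2))
    (hφ : ∀ H s l, transmitPower (φ.beam H s l) ≤ Ppeak) (l : ℕ) (i : Fin K) :
    Integrable (fun p : (ℕ → Channel K M N) × unitInterval =>
      receivedPower (p.1 l i) (φ.beam p.1 p.2 l)) (law ν) := by
  have h := (memLp_two_iff_integrable_sq ((φ.measurable_receivedPower_beam l i).const_sub
    (P i)).aestronglyMeasurable).2 (integrable_sub_receivedPower_sq hP hbound hφ l i).1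
  refine ((integrable_const (P i)).sub (h.integrable one_le_two)).congr (.of_forall fun p => ?_)
  simp

lemma integrable_transmitPower (hφ : ∀ H s l, transmitPower (φ.beam H s l) ≤ Ppeak) (l : ℕ) :
    Integrable (fun p : (ℕ → Channel K M N) × unitInterval =>
      transmitPower (φ.beam p.1 p.2 l)) (law ν) := by
  refine .of_bound (φ.measurable_transmitPower_beam l).aestronglyMeasurable Ppeak
    (.of_forall fun p => ?_)
  rw [Real.norm_of_nonneg (transmitPower_nonneg _)]
  exact hφ _ _ _

lemma integrable_queue (hP : ∀ i, 0 ≤ P i) (l : ℕ) (i : Fin K) :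
    Integrable (fun p : (ℕ → Channel K M N) × unitInterval => φ.queue P p.1 p.2 l i) (law ν) :=
  .of_bound (φ.measurable_queue P l i).aestronglyMeasurable _ (.of_forall (φ.norm_queue_le hP l i))

lemma queue_resample (l : ℕ) (i : Fin K) (h : Channel K M N)
    (p : (ℕ → Channel K M N) × unitInterval) :
    φ.queue P (resample l (h, p)).1 (resample l (h, p)).2 l i = φ.queue P p.1 p.2 l i :=
  congrFun (queue_congr p.2 fun _ hj => Function.update_of_ne hj.ne _ _) i

lemma integral_receivedPower_le (hP : ∀ i, 0 ≤ P i)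
    (hbound : ∀ i, ∫⁻ h, ENNReal.ofReal (max (P i) (maxReceivedPower Ppeak (h i)) ^ 2) ∂ν
      ≤ ENNReal.ofReal (Ppeak ^ 2))
    (hφ : ∀ H s l, transmitPower (φ.beam H s l) ≤ Ppeak) (l : ℕ) (i : Fin K) :
    ∫ p, receivedPower (p.1 l i) (φ.beam p.1 p.2 l) ∂(law ν) ≤ P i + (1 + Ppeak ^ 2) := by
  obtain ⟨h1, h2⟩ := integrable_sub_receivedPower_sq hP hbound hφ l i
  have h3 : Integrable (fun p : (ℕ → Channel K M N) × unitInterval => P i + (1 +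
      (P i - receivedPower (p.1 l i) (φ.beam p.1 p.2 l)) ^ 2)) (law ν) :=
    (integrable_const _).add ((integrable_const _).add h1)
  refine (integral_mono (integrable_receivedPower hP hbound hφ l i) h3 fun p => ?_).trans ?_
  · nlinarith [sq_nonneg (P i - receivedPower (p.1 l i) (φ.beam p.1 p.2 l) + 1 / 2)]
  · simp only [← add_assoc]
    rw [integral_add (integrable_const _) h1]
    simpa using h2

/-! ### Comparison with an arbitrary policy -/

variable {V : ℝ} {π : Policy K M N}

/-- In slot `l` the algorithm does at least as well as the following competitor: given the true
channel of slot `l`, it draws the rest of a trajectory and the seed afresh and applies the rule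
of slot `m` of `φ` to them.  Since the fresh data and the channel of slot `l` are independent of the
queues, the expectation of the competitor's score factorises. -/
lemma IsDriftPlusPenalty.compare_slot (hPpeak : 0 < Ppeak) (hP : ∀ i, 0 ≤ P i)
    (hbound : ∀ i, ∫⁻ h, ENNReal.ofReal (max (P i) (maxReceivedPower Ppeak (h i)) ^ 2) ∂ν
      ≤ ENNReal.ofReal (Ppeak ^ 2))
    (hπ : π.IsDriftPlusPenalty V Ppeak P)
    (hφ : ∀ H s l, transmitPower (φ.beam H s l) ≤ Ppeak) (l m : ℕ) :
    ∑ i, ∫ p, π.queue P p.1 p.2 l i *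
        (P i - receivedPower (p.1 l i) (π.beam p.1 p.2 l)) ∂(law ν)
      + V * ∫ p, transmitPower (π.beam p.1 p.2 l) ∂(law ν) ≤
    ∑ i, (∫ p, π.queue P p.1 p.2 l i ∂(law ν)) *
        (P i - ∫ p, receivedPower (p.1 m i) (φ.beam p.1 p.2 m) ∂(law ν))
      + V * ∫ p, transmitPower (φ.beam p.1 p.2 m) ∂(law ν) := by
  have hpeak := hπ.transmitPower_le hPpeak
  set A : Fin K → (ℕ → Channel K M N) × unitInterval → ℝ := fun i p =>
    receivedPower (p.1 m i) (φ.beam p.1 p.2 m) with hA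
  set T : (ℕ → Channel K M N) × unitInterval → ℝ := fun p =>
    transmitPower (φ.beam p.1 p.2 m) with hT
  have hAi : ∀ i, Integrable (A i) (law ν) := integrable_receivedPower hP hbound hφ m
  have hTi : Integrable T (law ν) := integrable_transmitPower hφ m
  have hrm : ∀ h : Channel K M N, Measurable fun p => resample m (h, p) := fun h =>
    (measurePreserving_resample ν m).measurable.comp measurable_prodMk_left
  have hAh : ∀ i h, Integrable (fun p => A i (resample m (h, p))) (law ν) := fun i h => by
    refine .of_bound ((φ.measurable_receivedPower_beam m i).comp (hrm h)).aestronglyMeasurable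
      (maxReceivedPower Ppeak (h i)) (.of_forall fun p => ?_)
    rw [Real.norm_of_nonneg (receivedPower_nonneg _ _)]
    have := receivedPower_le_maxReceivedPower ((resample m (h, p)).1 m i)
      (hφ (resample m (h, p)).1 (resample m (h, p)).2 m)
    rw [resample_slot] at this ⊢
    exact this
  have hTh : ∀ h, Integrable (fun p => T (resample m (h, p))) (law ν) := fun h => by
    refine .of_bound ((φ.measurable_transmitPower_beam m).comp (hrm h)).aestronglyMeasurable
      Ppeak (.of_forall fun p => ?_)
    rw [Real.norm_of_nonneg (transmitPower_nonneg _)]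
    exact hφ _ _ _
  have hs := measurePreserving_slot ν l
  have hAs : ∀ i, Integrable (fun p : (ℕ → Channel K M N) × unitInterval =>
      slotMean ν m (A i) (p.1 l)) (law ν) := fun i =>
    hs.integrable_comp_of_integrable (integrable_slotMean (hAi i))
  have hTs : Integrable (fun p : (ℕ → Channel K M N) × unitInterval =>
      slotMean ν m T (p.1 l)) (law ν) :=
    hs.integrable_comp_of_integrable (integrable_slotMean hTi)
  -- The pointwise comparison, averaged over the fresh trajectory.
  have hpt : ∀ p : (ℕ → Channel K M N) × unitInterval,
      ∑ i, π.queue P p.1 p.2 l i * (P i - receivedPower (p.1 l i) (π.beam p.1 p.2 l))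
        + V * transmitPower (π.beam p.1 p.2 l) ≤
      ∑ i, π.queue P p.1 p.2 l i * (P i - slotMean ν m (A i) (p.1 l))
        + V * slotMean ν m T (p.1 l) := by
    intro p
    have key : ∫ q, (∑ i, π.queue P p.1 p.2 l i * A i (resample m (p.1 l, q))
          - V * T (resample m (p.1 l, q))) ∂(law ν) ≤
        ∫ _, (∑ i, π.queue P p.1 p.2 l i * receivedPower (p.1 l i) (π.beam p.1 p.2 l)
          - V * transmitPower (π.beam p.1 p.2 l)) ∂(law ν) := by
      refine integral_mono ((integrable_finsetSum _ fun i _ => (hAh i _).const_mul _).sub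
        ((hTh _).const_mul _)) (integrable_const _) fun q => ?_
      have := hπ.optimal hPpeak p.1 p.2 l
        (hφ (resample m (p.1 l, q)).1 (resample m (p.1 l, q)).2 m)
      simpa only [hA, hT, resample_slot] using this
    rw [integral_sub (integrable_finsetSum _ fun i _ => (hAh i _).const_mul _)
      ((hTh _).const_mul _), integral_finsetSum _ fun i _ => (hAh i _).const_mul _] at key
    simp only [integral_const_mul, integral_const, probReal_univ, one_smul] at key
    simp only [mul_sub, Finset.sum_sub_distrib]
    simp only [slotMean]
    linarith
  have hL : ∀ i, Integrable (fun p : (ℕ → Channel K M N) × unitInterval =>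
      π.queue P p.1 p.2 l i * (P i - receivedPower (p.1 l i) (π.beam p.1 p.2 l))) (law ν) :=
    fun i => π.integrable_queue_mul hP l i
      ((integrable_const _).sub (integrable_receivedPower hP hbound hpeak l i))
  have hR : ∀ i, Integrable (fun p : (ℕ → Channel K M N) × unitInterval =>
      π.queue P p.1 p.2 l i * (P i - slotMean ν m (A i) (p.1 l))) (law ν) :=
    fun i => π.integrable_queue_mul hP l i ((integrable_const _).sub (hAs i))
  have hTl := integrable_transmitPower (ν := ν) hpeak l
  have h := integral_mono ((integrable_finsetSum _ fun i _ => hL i).add (hTl.const_mul V))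
    ((integrable_finsetSum _ fun i _ => hR i).add (hTs.const_mul V)) hpt
  rw [integral_add' (integrable_finsetSum _ fun i _ => hL i) (hTl.const_mul V),
    integral_add' (integrable_finsetSum _ fun i _ => hR i) (hTs.const_mul V),
    integral_finsetSum _ fun i _ => hL i, integral_finsetSum _ fun i _ => hR i,
    integral_const_mul, integral_const_mul] at h
  refine h.trans_eq ?_
  congr 1
  · refine Finset.sum_congr rfl fun i _ => ?_
    rw [integral_mul_slot (g := fun h => P i - slotMean ν m (A i) h) (queue_resample l i)
      (integrable_queue hP l i).1 ((integrable_const _).sub (integrable_slotMean (hAi i))).1,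
      integral_sub (integrable_const _) (integrable_slotMean (hAi i)),
      integral_slotMean (hAi i), integral_const, probReal_univ, one_smul]
  · rw [integral_slot (integrable_slotMean hTi).1, integral_slotMean hTi]

end Policy
end Expectation

section Averages

variable {K M N : ℕ} {ν : Measure (Channel K M N)}

/-! ### Long-term averages -/

lemma one_div_mul_sum_le {a : ℕ → ℝ} {C : ℝ} (hC : 0 ≤ C) (ha : ∀ l, a l ≤ C) (L : ℕ) :
    1 / (L : ℝ) * ∑ l ∈ Finset.range L, a l ≤ C := by
  rcases Nat.eq_zero_or_pos L with rfl | hL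
  · simpa using hC
  · have hL' : (0 : ℝ) < L := Nat.cast_pos.2 hL
    rw [one_div, inv_mul_le_iff₀ hL']
    calc ∑ l ∈ Finset.range L, a l ≤ ∑ _l ∈ Finset.range L, C :=
          Finset.sum_le_sum fun l _ => ha l
      _ = L * C := by simp

namespace Policy

variable {Ppeak V : ℝ} {P : Fin K → ℝ} {φ π : Policy K M N}

lemma meanTransmit_nonneg (L : ℕ) : 0 ≤ φ.meanTransmit ν L :=
  mul_nonneg (by positivity) (Finset.sum_nonneg fun _ _ =>
    integral_nonneg fun _ => transmitPower_nonneg _)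

lemma meanReceived_nonneg (i : Fin K) (L : ℕ) : 0 ≤ φ.meanReceived ν i L :=
  mul_nonneg (by positivity) (Finset.sum_nonneg fun _ _ =>
    integral_nonneg fun _ => receivedPower_nonneg _ _)

lemma isBoundedUnder_meanTransmit :
    IsBoundedUnder (· ≥ ·) atTop (φ.meanTransmit ν) :=
  isBoundedUnder_of ⟨0, meanTransmit_nonneg⟩

variable [IsProbabilityMeasure ν]

lemma meanTransmit_le (hPpeak : 0 ≤ Ppeak)
    (hφ : ∀ H s l, transmitPower (φ.beam H s l) ≤ Ppeak) (L : ℕ) :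
    φ.meanTransmit ν L ≤ Ppeak := by
  refine one_div_mul_sum_le hPpeak (fun l => ?_) L
  refine (integral_mono (integrable_transmitPower hφ l) (integrable_const Ppeak)
    fun p => hφ _ _ _).trans_eq ?_
  simp

lemma meanReceived_le (hP : ∀ i, 0 ≤ P i)
    (hbound : ∀ i, ∫⁻ h, ENNReal.ofReal (max (P i) (maxReceivedPower Ppeak (h i)) ^ 2) ∂ν
      ≤ ENNReal.ofReal (Ppeak ^ 2))
    (hφ : ∀ H s l, transmitPower (φ.beam H s l) ≤ Ppeak) (i : Fin K) (L : ℕ) :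
    φ.meanReceived ν i L ≤ P i + (1 + Ppeak ^ 2) :=
  one_div_mul_sum_le (by have := hP i; positivity)
    (fun l => integral_receivedPower_le hP hbound hφ l i) L

lemma isCoboundedUnder_meanTransmit (hPpeak : 0 ≤ Ppeak)
    (hφ : ∀ H s l, transmitPower (φ.beam H s l) ≤ Ppeak) :
    IsCoboundedUnder (· ≥ ·) atTop (φ.meanTransmit ν) :=
  (isBoundedUnder_of ⟨Ppeak, meanTransmit_le hPpeak hφ⟩).isCoboundedUnder_ge

/-- Averaging `IsDriftPlusPenalty.compare_slot` over the slots of `φ`: the score of the algorithm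
in every slot is at most `V` times the long-term power of any feasible policy. -/
lemma IsDriftPlusPenalty.compare_liminf (hPpeak : 0 < Ppeak) (hV : 0 < V) (hP : ∀ i, 0 ≤ P i)
    (hbound : ∀ i, ∫⁻ h, ENNReal.ofReal (max (P i) (maxReceivedPower Ppeak (h i)) ^ 2) ∂ν
      ≤ ENNReal.ofReal (Ppeak ^ 2))
    (hπ : π.IsDriftPlusPenalty V Ppeak P) (hφ : φ.IsFeasible ν Ppeak P) (l : ℕ) :
    ∑ i, ∫ p, π.queue P p.1 p.2 l i *
        (P i - receivedPower (p.1 l i) (π.beam p.1 p.2 l)) ∂(law ν)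
      + V * ∫ p, transmitPower (π.beam p.1 p.2 l) ∂(law ν) ≤
    V * liminf (φ.meanTransmit ν) atTop := by
  set D := ∑ i, ∫ p, π.queue P p.1 p.2 l i *
        (P i - receivedPower (p.1 l i) (π.beam p.1 p.2 l)) ∂(law ν)
      + V * ∫ p, transmitPower (π.beam p.1 p.2 l) ∂(law ν) with hD
  set Z : Fin K → ℝ := fun i => ∫ p, π.queue P p.1 p.2 l i ∂(law ν) with hZ
  have hZ0 : ∀ i, 0 ≤ Z i := fun i => integral_nonneg fun p => queue_nonneg _ _ _ _
  have hmean : ∀ L : ℕ, 0 < L →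
      D ≤ ∑ i, Z i * (P i - φ.meanReceived ν i L) + V * φ.meanTransmit ν L := by
    intro L hL
    have hL' : (0 : ℝ) < L := Nat.cast_pos.2 hL
    have h := Finset.sum_le_sum fun m (_ : m ∈ Finset.range L) =>
      hπ.compare_slot hPpeak hP hbound hφ.1 l m
    rw [Finset.sum_const, Finset.card_range, nsmul_eq_mul, ← hD, Finset.sum_add_distrib,
      Finset.sum_comm, ← Finset.mul_sum] at h
    simp only [← Finset.mul_sum, Finset.sum_sub_distrib, Finset.sum_const, Finset.card_range,
      nsmul_eq_mul] at h
    have h1 : ∀ i, (L : ℝ) * φ.meanReceived ν i L = ∑ m ∈ Finset.range L,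
        ∫ p, receivedPower (p.1 m i) (φ.beam p.1 p.2 m) ∂(law ν) := fun i => by
      rw [meanReceived, one_div, mul_inv_cancel_left₀ hL'.ne']
    have h2 : (L : ℝ) * φ.meanTransmit ν L = ∑ m ∈ Finset.range L,
        ∫ p, transmitPower (φ.beam p.1 p.2 m) ∂(law ν) := by
      rw [meanTransmit, one_div, mul_inv_cancel_left₀ hL'.ne']
    simp only [← h1, ← h2] at h
    refine le_of_mul_le_mul_left (h.trans_eq ?_) hL'
    rw [mul_add, Finset.mul_sum]
    congr 1
    · exact Finset.sum_congr rfl fun i _ => by ring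
    · ring
  have hS : 0 ≤ ∑ i, Z i := Finset.sum_nonneg fun i _ => hZ0 i
  refine le_of_forall_pos_le_add fun ε hε => ?_
  set δ := ε / (∑ i, Z i + V) with hδ
  have hδ0 : 0 < δ := by positivity
  have hrec : ∀ᶠ L in atTop, ∀ i, P i - δ < φ.meanReceived ν i L := by
    refine eventually_all.2 fun i => eventually_lt_of_lt_liminf ?_
      (isBoundedUnder_of ⟨0, meanReceived_nonneg i⟩)
    linarith [hφ.2 i]
  have htr : ∃ᶠ L in atTop, φ.meanTransmit ν L < liminf (φ.meanTransmit ν) atTop + δ :=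
    frequently_lt_of_liminf_lt (isCoboundedUnder_meanTransmit hPpeak.le hφ.1) (by linarith)
  obtain ⟨L, ⟨hL1, hL2⟩, hL3⟩ :=
    (htr.and_eventually (hrec.and (eventually_gt_atTop 0))).exists.imp
      fun L h => (⟨⟨h.1, h.2.1⟩, h.2.2⟩ : (_ ∧ _) ∧ _)
  calc D ≤ ∑ i, Z i * (P i - φ.meanReceived ν i L) + V * φ.meanTransmit ν L := hmean L hL3
    _ ≤ ∑ i, Z i * δ + V * (liminf (φ.meanTransmit ν) atTop + δ) := by
        refine add_le_add (Finset.sum_le_sum fun i _ => ?_) (by gcongr)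
        exact mul_le_mul_of_nonneg_left (by linarith [hL2 i]) (hZ0 i)
    _ = V * liminf (φ.meanTransmit ν) atTop + δ * (∑ i, Z i + V) := by
        rw [← Finset.sum_mul]; ring
    _ = V * liminf (φ.meanTransmit ν) atTop + ε := by
        rw [hδ, div_mul_cancel₀ _ (by positivity)]

/-! ### Lyapunov drift -/

lemma integrable_queue_sq (hP : ∀ i, 0 ≤ P i) (l : ℕ) (i : Fin K) :
    Integrable (fun p : (ℕ → Channel K M N) × unitInterval => π.queue P p.1 p.2 l i ^ 2)
      (law ν) := by
  simp only [sq]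
  exact π.integrable_queue_mul hP l i (integrable_queue hP l i)

/-- The Lyapunov function `½ ∑ Z_i²` together with the penalty spent up to slot `L` grows at most
linearly. -/
lemma IsDriftPlusPenalty.lyapunov_le (hPpeak : 0 < Ppeak) (hV : 0 < V) (hP : ∀ i, 0 ≤ P i)
    (hbound : ∀ i, ∫⁻ h, ENNReal.ofReal (max (P i) (maxReceivedPower Ppeak (h i)) ^ 2) ∂ν
      ≤ ENNReal.ofReal (Ppeak ^ 2))
    (hπ : π.IsDriftPlusPenalty V Ppeak P) (hφ : φ.IsFeasible ν Ppeak P) (L : ℕ) :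
    1 / 2 * ∑ i, ∫ p, π.queue P p.1 p.2 L i ^ 2 ∂(law ν)
      + V * ∑ l ∈ Finset.range L, ∫ p, transmitPower (π.beam p.1 p.2 l) ∂(law ν) ≤
    L * ((K : ℝ) / 2 * Ppeak ^ 2 + V * liminf (φ.meanTransmit ν) atTop) := by
  have hpeak := hπ.transmitPower_le hPpeak
  induction L with
  | zero => simp [queue]
  | succ l ih =>
    have hstep : ∀ i, ∫ p, π.queue P p.1 p.2 (l + 1) i ^ 2 ∂(law ν) ≤
        ∫ p, π.queue P p.1 p.2 l i ^ 2 ∂(law ν)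
          + 2 * ∫ p, π.queue P p.1 p.2 l i *
            (P i - receivedPower (p.1 l i) (π.beam p.1 p.2 l)) ∂(law ν) + Ppeak ^ 2 := by
      intro i
      obtain ⟨h1, h2⟩ := integrable_sub_receivedPower_sq hP hbound hpeak l i
      have h3 := π.integrable_queue_mul hP l i ((integrable_const (P i)).sub
        (integrable_receivedPower hP hbound hpeak l i))
      have h4 := integrable_queue_sq (ν := ν) (π := π) hP l i
      have h := integral_mono (integrable_queue_sq hP (l + 1) i)
        ((h4.add (h3.const_mul 2)).add h1) fun p => π.queue_succ_sq_le p.1 p.2 l i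
      rw [integral_add' (h4.add (h3.const_mul 2)) h1, integral_add' h4 (h3.const_mul 2),
        integral_const_mul] at h
      exact h.trans (add_le_add_right h2 _)
    have hsum := Finset.sum_le_sum fun i (_ : i ∈ Finset.univ) => hstep i
    rw [Finset.sum_add_distrib, Finset.sum_add_distrib, ← Finset.mul_sum, Finset.sum_const,
      Finset.card_univ, Fintype.card_fin, nsmul_eq_mul] at hsum
    have hc := hπ.compare_liminf hPpeak hV hP hbound hφ l
    rw [Finset.sum_range_succ]
    push_cast
    linarith

/-- Every feasible policy bounds the average power of the algorithm. -/
lemma IsDriftPlusPenalty.meanTransmit_le_add (hPpeak : 0 < Ppeak) (hV : 0 < V)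
    (hP : ∀ i, 0 ≤ P i)
    (hbound : ∀ i, ∫⁻ h, ENNReal.ofReal (max (P i) (maxReceivedPower Ppeak (h i)) ^ 2) ∂ν
      ≤ ENNReal.ofReal (Ppeak ^ 2))
    (hπ : π.IsDriftPlusPenalty V Ppeak P) (hφ : φ.IsFeasible ν Ppeak P) {L : ℕ} (hL : 0 < L) :
    π.meanTransmit ν L ≤
      liminf (φ.meanTransmit ν) atTop + ((K : ℝ) / 2 * Ppeak ^ 2) / V := by
  have hL' : (0 : ℝ) < L := Nat.cast_pos.2 hL
  have h := hπ.lyapunov_le hPpeak hV hP hbound hφ L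
  have h0 : 0 ≤ ∑ i, ∫ p, π.queue P p.1 p.2 L i ^ 2 ∂(law ν) :=
    Finset.sum_nonneg fun i _ => integral_nonneg fun p => sq_nonneg _
  rw [meanTransmit, one_div, inv_mul_le_iff₀ hL']
  refine le_of_mul_le_mul_left (a := V) ?_ hV
  calc _ ≤ L * ((K : ℝ) / 2 * Ppeak ^ 2 + V * liminf (φ.meanTransmit ν) atTop) := by linarith
    _ = _ := by field_simp; ring

/-- The queues of the algorithm are mean rate stable, `E Z_i[L] = o(L)`, and `Z_i[L]` is at least
the accumulated deficit of receiver `i`. -/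
lemma IsDriftPlusPenalty.isFeasible (hPpeak : 0 < Ppeak) (hV : 0 < V) (hP : ∀ i, 0 ≤ P i)
    (hbound : ∀ i, ∫⁻ h, ENNReal.ofReal (max (P i) (maxReceivedPower Ppeak (h i)) ^ 2) ∂ν
      ≤ ENNReal.ofReal (Ppeak ^ 2))
    (hπ : π.IsDriftPlusPenalty V Ppeak P) (hφ : φ.IsFeasible ν Ppeak P) :
    π.IsFeasible ν Ppeak P := by
  have hpeak := hπ.transmitPower_le hPpeak
  refine ⟨hpeak, fun i => le_of_forall_pos_le_add fun ε hε => ?_⟩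
  set C := (K : ℝ) / 2 * Ppeak ^ 2 + V * liminf (φ.meanTransmit ν) atTop with hC
  rw [← sub_le_iff_le_add]
  refine le_liminf_of_le
    (isBoundedUnder_of ⟨_, meanReceived_le hP hbound hpeak i⟩).isCoboundedUnder_ge ?_
  obtain ⟨n, hn⟩ := exists_nat_ge (2 * C / ε ^ 2)
  filter_upwards [eventually_gt_atTop 0, eventually_ge_atTop n] with L hL hnL
  have hL' : (0 : ℝ) < L := Nat.cast_pos.2 hL
  have hCL : 2 * C ≤ ε ^ 2 * L := by
    rw [div_le_iff₀ (by positivity)] at hn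
    have : (n : ℝ) ≤ L := Nat.cast_le.2 hnL
    nlinarith [sq_nonneg ε]
  -- The second moment of the queue grows at most linearly.
  have hsq : ∫ p, π.queue P p.1 p.2 L i ^ 2 ∂(law ν) ≤ 2 * (L * C) := by
    have h := hπ.lyapunov_le hPpeak hV hP hbound hφ L
    rw [← hC] at h
    have h1 := Finset.single_le_sum (f := fun i => ∫ p, π.queue P p.1 p.2 L i ^ 2 ∂(law ν))
      (fun i _ => integral_nonneg fun p => sq_nonneg _) (Finset.mem_univ i)
    have h2 : 0 ≤ V * ∑ l ∈ Finset.range L,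
        ∫ p, transmitPower (π.beam p.1 p.2 l) ∂(law ν) :=
      mul_nonneg hV.le (Finset.sum_nonneg fun l _ =>
        integral_nonneg fun p => transmitPower_nonneg _)
    linarith
  have hri := integrable_receivedPower hP hbound hpeak
  have hdef : L * (P i - π.meanReceived ν i L) ≤ ∫ p, π.queue P p.1 p.2 L i ∂(law ν) := by
    have h := integral_mono (integrable_finsetSum (Finset.range L) fun l _ =>
      (integrable_const (P i)).sub (hri l i)) (integrable_queue (ν := ν) hP L i)
      fun p => π.sum_le_queue p.1 p.2 L i
    rw [integral_finsetSum _ fun l _ => (integrable_const (P i)).sub (hri l i)] at h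
    refine le_of_eq_of_le ?_ h
    rw [mul_sub, meanReceived, one_div, mul_inv_cancel_left₀ hL'.ne']
    simp only [Pi.sub_apply]
    rw [Finset.sum_congr rfl fun l _ => integral_sub (integrable_const (P i)) (hri l i)]
    simp
  -- `2 a Z ≤ a² + Z²` with `a = ε L` replaces the Cauchy–Schwarz inequality `(E Z)² ≤ E Z²`.
  have hamgm : 2 * (ε * L) * ∫ p, π.queue P p.1 p.2 L i ∂(law ν) ≤
      (ε * L) ^ 2 + ∫ p, π.queue P p.1 p.2 L i ^ 2 ∂(law ν) := by
    have h := integral_mono ((integrable_queue (ν := ν) (φ := π) hP L i).const_mul (2 * (ε * L)))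
      ((integrable_const ((ε * L) ^ 2)).add (integrable_queue_sq hP L i))
      fun p => two_mul_le_add_sq _ _
    rw [integral_const_mul, integral_add' (integrable_const _) (integrable_queue_sq hP L i)] at h
    simpa using h
  have hfin : 2 * (ε * L) * (L * (P i - π.meanReceived ν i L)) ≤ 2 * (ε * L) * (L * ε) := by
    calc _ ≤ 2 * (ε * L) * ∫ p, π.queue P p.1 p.2 L i ∂(law ν) := by gcongr
      _ ≤ (ε * L) ^ 2 + L * (ε ^ 2 * L) := by
        refine hamgm.trans (add_le_add_right (hsq.trans ?_) _)
        calc 2 * (L * C) = L * (2 * C) := by ring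
          _ ≤ _ := by gcongr
      _ = _ := by ring
  have := le_of_mul_le_mul_left (le_of_mul_le_mul_left hfin (by positivity)) hL'
  linarith

end Policy
end Averages
end WPT

theorem theorem2 (K M N : ℕ) (ν : MeasureTheory.Measure (WPT.Channel K M N))
    [MeasureTheory.IsProbabilityMeasure ν]
    (Ppeak V : ℝ) (hPpeak : 0 < Ppeak) (hV : 0 < V)
    (P : Fin K → ℝ) (hP : ∀ i, 0 ≤ P i)
    (hbound : ∀ i, ∫⁻ h, ENNReal.ofReal (max (P i) (WPT.maxReceivedPower Ppeak (h i)) ^ 2) ∂ν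
      ≤ ENNReal.ofReal (Ppeak ^ 2))
    (hfeasible : ∃ φ : WPT.Policy K M N, φ.IsFeasible ν Ppeak P)
    (π : WPT.Policy K M N) (hπ : π.IsDriftPlusPenalty V Ppeak P) :
    π.IsFeasible ν Ppeak P ∧
    WPT.optimalPower ν Ppeak P ≤ Filter.liminf (π.meanTransmit ν) Filter.atTop ∧
    Filter.limsup (π.meanTransmit ν) Filter.atTop
      ≤ WPT.optimalPower ν Ppeak P + ((K : ℝ) / 2 * Ppeak ^ 2) / V := by
  obtain ⟨φ, hφ⟩ := hfeasible
  have hfeas := hπ.isFeasible hPpeak hV hP hbound hφ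
  refine ⟨hfeas, csInf_le ⟨0, ?_⟩ ⟨π, hfeas, rfl⟩, ?_⟩
  · rintro _ ⟨ψ, hψ, rfl⟩
    exact le_liminf_of_le (WPT.Policy.isCoboundedUnder_meanTransmit hPpeak.le hψ.1)
      (.of_forall WPT.Policy.meanTransmit_nonneg)
  · rw [← sub_le_iff_le_add]
    refine le_csInf ⟨_, φ, hφ, rfl⟩ ?_
    rintro _ ⟨ψ, hψ, rfl⟩
    rw [sub_le_iff_le_add]
    refine limsup_le_of_le WPT.Policy.isBoundedUnder_meanTransmit.isCoboundedUnder_le ?_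
    filter_upwards [eventually_gt_atTop 0] with L hL
    exact hπ.meanTransmit_le_add hPpeak hV hP hbound hψ hL
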